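/- Let $\ell\ge 1$ be an integer and let $\Sigma_\ell=\{a_1<a_2<\cdots<a_\ell\}$ be an ordered alphabet. Let $\mathcal B_\ell=a_1^*a_2^*\cdots a_\ell^*=\{a_1^{j_1}a_2^{j_2}\cdots a_\ell^{j_\ell}: j_1,\dots,j_\ell\ge 0\}$, and order its words genealogically: shorter words come first, and words of the same length are compared lexicographically. For an integer $n\ge 0$ let $\mathrm{rep}_\ell(n)$ be the $(n+1)$-st word of $\mathcal B_\ell$ in this order, and let $\mathrm{val}_\ell:\mathcal B_\ell\to\mathbb N$ be the inverse of the bijection $\mathrm{rep}_\ell:\mathbb N\to\mathcal B_\ell$; thus $\mathrm{val}_\ell(w)$ is the number of words of $\mathcal B_\ell$ that precede $w$. For an integer $\lambda\ge 1$ let $f_\lambda:\mathcal B_\ell\to\mathcal B_\ell$ be multiplication by $\lambda$, that is, $f_\lambda(w)=\mathrm{rep}_\ell(\lambda\,\mathrm{val}_\ell(w))$. **Proposition.** Let $\ell\ge 3$ and $\beta\ge 2$ be integers. If $$\frac{(\beta-1)(\ell+1)}{2}\notin\mathbb Z\qquad\text{or}\qquad \frac{(\beta^2-1)(\ell+1)}{24}\notin\mathbb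 Z,$$ then the language $f_{\beta^\ell}(a_\ell^*)=\{f_{\beta^\ell}(a_\ell^q): q\ge 0\}$ is not regular (it is not accepted by any finite automaton). -/

import Mathlib

namespace BoundedNumeration

noncomputable section

/-- The genealogical (radix, shortlex) order on words over an ordered alphabet: shorter words come
first, words of equal length are compared lexicographically. -/
def GenLT {α : Type*} [LT α] (u v : List α) : Prop :=
  List.Shortlex (fun a b : α => a < b) u v

/-- The numerical value of a word `w` in the abstract numeration system built on `L`:
the number of words of `L` that are genealogically less than `w`. So the `(n+1)`-st word of `L`
has value `n`. -/
def val {α : Type*} [LT α] (L : Language α) (w : List α) : ℕ :=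
  Set.ncard {v : List α | v ∈ L ∧ GenLT v w}

/-- The representation of `n` in the abstract numeration system built on `L`: the `(n+1)`-st word
of `L` in genealogical order, that is the word of `L` whose value is `n`. -/
def rep {α : Type*} [LT α] (L : Language α) (n : ℕ) : List α :=
  Function.invFunOn (val L) {w : List α | w ∈ L} n

/-- The word `a₁ ^ j₁ a₂ ^ j₂ ⋯ a_ℓ ^ j_ℓ`. The alphabet `a₁ < a₂ < ⋯ < a_ℓ` is `Fin ℓ`,
with its usual order. -/
def powWord (ℓ : ℕ) (j : Fin ℓ → ℕ) : List (Fin ℓ) :=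
  (List.ofFn fun i : Fin ℓ => List.replicate (j i) i).flatten

/-- The bounded language `a₁* a₂* ⋯ a_ℓ*`. -/
def boundedLang (ℓ : ℕ) : Language (Fin ℓ) :=
  {w : List (Fin ℓ) | ∃ j : Fin ℓ → ℕ, w = powWord ℓ j}

/-- Multiplication by `m`, transported from `ℕ` to the words of the bounded language `a₁* ⋯ a_ℓ*`:
`w ↦ rep (m * val w)`. -/
def mulMap (ℓ m : ℕ) (w : List (Fin ℓ)) : List (Fin ℓ) :=
  rep (boundedLang ℓ) (m * val (boundedLang ℓ) w)

/-- The image of a language under multiplication by `m`. -/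
def mulImage (ℓ m : ℕ) (K : Language (Fin ℓ)) : Language (Fin ℓ) :=
  {u : List (Fin ℓ) | ∃ w : List (Fin ℓ), w ∈ K ∧ mulMap ℓ m w = u}

/-- The language `a*` of all powers of the letter `a`. -/
def letterStar {ℓ : ℕ} (a : Fin ℓ) : Language (Fin ℓ) :=
  {w : List (Fin ℓ) | ∃ q : ℕ, w = List.replicate q a}

/-! Sanity of the definitions: `val` is a bijection from `L` onto `ℕ`, with inverse `rep`. -/

theorem genLT_trans {α : Type*} [LinearOrder α] {u v w : List α} (h₁ : GenLT u v)
    (h₂ : GenLT v w) : GenLT u w := by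
  unfold GenLT at *
  rw [List.shortlex_def] at *
  rcases h₁ with h₁ | ⟨h₁, h₁'⟩ <;> rcases h₂ with h₂ | ⟨h₂, h₂'⟩
  · left; omega
  · left; omega
  · left; omega
  · right
    refine ⟨h₁.trans h₂, ?_⟩
    have a₁ : u < v := h₁'
    have a₂ : v < w := h₂'
    exact (a₁.trans a₂ : u < w)

theorem genLT_irrefl {α : Type*} [LinearOrder α] (u : List α) : ¬ GenLT u u := by
  intro h
  unfold GenLT at h
  rw [List.shortlex_def] at h
  rcases h with h | ⟨-, h⟩
  · omega
  · exact lt_irrefl u (h : u < u)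

theorem genLT_total {α : Type*} [LinearOrder α] {u v : List α} (h : u ≠ v) :
    GenLT u v ∨ GenLT v u := by
  unfold GenLT
  rw [List.shortlex_def, List.shortlex_def]
  rcases lt_trichotomy u.length v.length with h' | h' | h'
  · exact Or.inl (Or.inl h')
  · rcases lt_or_gt_of_ne h with h'' | h''
    · exact Or.inl (Or.inr ⟨h', h''⟩)
    · exact Or.inr (Or.inr ⟨h'.symm, h''⟩)
  · exact Or.inr (Or.inl h')

theorem finite_genLT {α : Type*} [Finite α] [LinearOrder α] (L : Language α) (w : List α) :
    {v : List α | v ∈ L ∧ GenLT v w}.Finite := by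
  refine (List.finite_length_le α w.length).subset ?_
  rintro v ⟨-, hv⟩
  unfold GenLT at hv
  rw [List.shortlex_def] at hv
  rcases hv with hv | hv
  · exact hv.le
  · exact hv.1.le

theorem val_lt {α : Type*} [Finite α] [LinearOrder α] {L : Language α} {v w : List α}
    (hv : v ∈ L) (h : GenLT v w) : val L v < val L w := by
  refine Set.ncard_lt_ncard ?_ (finite_genLT L w)
  refine ⟨fun x hx => ⟨hx.1, genLT_trans hx.2 h⟩, fun hs => ?_⟩
  exact genLT_irrefl v (hs (show v ∈ L ∧ GenLT v w from ⟨hv, h⟩)).2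

theorem val_injOn {α : Type*} [Finite α] [LinearOrder α] (L : Language α) :
    Set.InjOn (val L) {w : List α | w ∈ L} := by
  intro u hu v hv h
  by_contra hne
  rcases genLT_total hne with h' | h'
  · exact absurd h (val_lt hu h').ne
  · exact absurd h (val_lt hv h').ne'

theorem exists_val_eq {α : Type*} [Finite α] [LinearOrder α] {L : Language α}
    (hL : {w : List α | w ∈ L}.Infinite) (n : ℕ) : ∃ w ∈ L, val L w = n := by
  have himg : (val L '' {w : List α | w ∈ L}).Infinite := hL.image (val_injOn L)
  obtain ⟨_, ⟨w, hw, rfl⟩, hnw⟩ := himg.exists_gt n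
  -- on the words of `L` below `w`, `val` takes `val L w` distinct values, all below `val L w`
  set S := {v : List α | v ∈ L ∧ GenLT v w} with hS
  have hsub : val L '' S ⊆ Set.Iio (val L w) := by
    rintro _ ⟨v, hv, rfl⟩
    exact val_lt hv.1 hv.2
  have hcard : (val L '' S).ncard = (Set.Iio (val L w)).ncard := by
    rw [((val_injOn L).mono fun v hv => hv.1).ncard_image]
    simp [Set.ncard_eq_toFinset_card', hS, val]
  have heq := Set.eq_of_subset_of_ncard_le hsub hcard.ge (Set.finite_Iio _)
  have hn : n ∈ val L '' S := heq ▸ hnw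
  obtain ⟨v, hv, rfl⟩ := hn
  exact ⟨v, hv.1, rfl⟩

theorem rep_mem {α : Type*} [Finite α] [LinearOrder α] {L : Language α}
    (hL : {w : List α | w ∈ L}.Infinite) (n : ℕ) : rep L n ∈ L :=
  Function.invFunOn_mem (exists_val_eq hL n)

theorem val_rep {α : Type*} [Finite α] [LinearOrder α] {L : Language α}
    (hL : {w : List α | w ∈ L}.Infinite) (n : ℕ) : val L (rep L n) = n :=
  Function.invFunOn_eq (exists_val_eq hL n)

theorem length_powWord (ℓ : ℕ) (j : Fin ℓ → ℕ) : (powWord ℓ j).length = ∑ i, j i := by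
  simp [powWord, List.length_flatten, List.map_ofFn, Function.comp_def, List.sum_ofFn]

theorem infinite_boundedLang {ℓ : ℕ} (hℓ : 1 ≤ ℓ) :
    {w : List (Fin ℓ) | w ∈ boundedLang ℓ}.Infinite := by
  refine Set.infinite_of_injective_forall_mem
    (f := fun q : ℕ => powWord ℓ (Pi.single ⟨0, hℓ⟩ q)) ?_ fun q => ⟨_, rfl⟩
  intro p q h
  have := congrArg List.length h
  simpa [length_powWord] using this

end

end BoundedNumeration

namespace BoundedNumeration

open Filter Topology

/-! There are `C(n+ℓ-1, ℓ)` words shorter than `n`, and words of equal length are ordered as their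
tails without the first letter; hence the value of a word is a sum of binomial coefficients
(`wordValue`, `val_powWord`).

If the image were regular, some word of it could be pumped in one letter (`exists_pump_powWord`).
This gives infinitely many solutions of `β^ℓ (C(q+ℓ, ℓ) - 1) = C(n+ℓ-1, ℓ) + u`, where `n` is the
length and `u` the value of the tail. Times `ℓ!`, both main terms are products of `ℓ` terms in
arithmetic progression, with steps `β` and `1`. The coefficient of `n^(ℓ-1)` fixes the integer `βq -
n`; that of `n^(ℓ-2)` then gives an exact identity (`second_order_comparison`).

Pumping the first letter keeps `u` bounded and forces `β² = 1`. Pumping another letter gives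
`(β-1)(ℓ+1)/2 = n - βq` and `(β²-1)(ℓ+1)/24 = d + 1 - e`, where `d` is the exponent of the first
letter and `e` is `0` for the second letter, `1` for later ones. Both are integers, against the
hypothesis. -/

/-! ### Values of words as sums of binomial coefficients -/

theorem powWord_succ (ℓ : ℕ) (j : Fin (ℓ + 1) → ℕ) :
    powWord (ℓ + 1) j =
      List.replicate (j 0) 0 ++ (powWord ℓ (Fin.tail j)).map Fin.succ := by
  simp [powWord, List.ofFn_succ, List.map_flatten, List.map_ofFn, Function.comp_def, Fin.tail]

/-- The combinatorial value of the word `a₁ ^ j₁ ⋯ a_ℓ ^ j_ℓ`. -/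
def wordValue : (ℓ : ℕ) → (Fin ℓ → ℕ) → ℕ
  | 0, _ => 0
  | ℓ + 1, j => (∑ i, j i + ℓ).choose (ℓ + 1) + wordValue ℓ (Fin.tail j)

theorem sum_tail_add (ℓ : ℕ) (j : Fin (ℓ + 1) → ℕ) :
    ∑ i, j i = j 0 + ∑ i, Fin.tail j i := by
  rw [Fin.sum_univ_succ]; rfl

theorem wordValue_lt (ℓ : ℕ) (j : Fin ℓ → ℕ) : wordValue ℓ j < (∑ i, j i + ℓ).choose ℓ := by
  induction ℓ with
  | zero => simp [wordValue]
  | succ ℓ ih =>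
    have h1 := ih (Fin.tail j)
    have h2 : (∑ i, Fin.tail j i + ℓ).choose ℓ ≤ (∑ i, j i + ℓ).choose ℓ :=
      Nat.choose_le_choose _ (by rw [sum_tail_add]; omega)
    have h3 : (∑ i, j i + (ℓ + 1)).choose (ℓ + 1) =
      (∑ i, j i + ℓ).choose ℓ + (∑ i, j i + ℓ).choose (ℓ + 1) := Nat.choose_succ_succ _ _
    rw [wordValue]; omega

theorem choose_le_wordValue (ℓ : ℕ) (hℓ : 1 ≤ ℓ) (j : Fin ℓ → ℕ) :
    (∑ i, j i + ℓ - 1).choose ℓ ≤ wordValue ℓ j := by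
  obtain ⟨ℓ, rfl⟩ := Nat.exists_eq_add_of_le' hℓ
  simp [wordValue]

theorem wordValue_lt_of_sum_lt {ℓ : ℕ} {i j : Fin ℓ → ℕ} (h : ∑ k, i k < ∑ k, j k) :
    wordValue ℓ i < wordValue ℓ j := by
  rcases Nat.eq_zero_or_pos ℓ with rfl | hℓ
  · simp at h
  · refine ((wordValue_lt ℓ i).trans_le (Nat.choose_le_choose _ ?_)).trans_le
      (choose_le_wordValue ℓ hℓ j)
    omega

theorem eq_of_tail_eq {ℓ : ℕ} {i j : Fin (ℓ + 1) → ℕ} (h : ∑ k, i k = ∑ k, j k)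
    (ht : Fin.tail i = Fin.tail j) : i = j := by
  rw [sum_tail_add, sum_tail_add, ht] at h
  rw [← Fin.cons_self_tail i, ← Fin.cons_self_tail j, ht, Nat.add_right_cancel h]

theorem wordValue_injective (ℓ : ℕ) : Function.Injective (wordValue ℓ) := by
  induction ℓ with
  | zero => intro i j _; exact Subsingleton.elim _ _
  | succ ℓ ih =>
    intro i j h
    rcases lt_trichotomy (∑ k, i k) (∑ k, j k) with h' | h' | h'
    · exact absurd h (wordValue_lt_of_sum_lt h').ne
    · refine eq_of_tail_eq h' (ih ?_)
      rw [wordValue, wordValue, h'] at h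
      exact Nat.add_left_cancel h
    · exact absurd h (wordValue_lt_of_sum_lt h').ne'

/-- The length bound is part of the induction: the tail must be short enough to be padded by the
first letter to length exactly `n + 1`. -/
theorem exists_wordValue_eq_of_lt (ℓ n N : ℕ) (h : N < (n + ℓ).choose ℓ) :
    ∃ j : Fin ℓ → ℕ, ∑ i, j i ≤ n ∧ wordValue ℓ j = N := by
  induction ℓ generalizing n N with
  | zero => exact ⟨Fin.elim0, by simp, by simp at h; simp [wordValue, h]⟩
  | succ ℓ ih =>
    induction n with
    | zero =>
      refine ⟨0, by simp, ?_⟩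
      have := wordValue_lt (ℓ + 1) 0
      simp at this h
      omega
    | succ n ihn =>
      rcases lt_or_ge N ((n + (ℓ + 1)).choose (ℓ + 1)) with h' | h'
      · obtain ⟨j, hj, hN⟩ := ihn h'
        exact ⟨j, by omega, hN⟩
      · have h3 : (n + 1 + (ℓ + 1)).choose (ℓ + 1) =
          (n + 1 + ℓ).choose ℓ + (n + 1 + ℓ).choose (ℓ + 1) := Nat.choose_succ_succ _ _
        rw [show n + (ℓ + 1) = n + 1 + ℓ by omega] at h'
        obtain ⟨j, hj, hN⟩ := ih (n + 1) (N - (n + 1 + ℓ).choose (ℓ + 1)) (by omega)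
        have hs : ∑ i, (Fin.cons (n + 1 - ∑ i, j i) j : Fin (ℓ + 1) → ℕ) i = n + 1 := by
          rw [Fin.sum_cons]; omega
        refine ⟨Fin.cons (n + 1 - ∑ i, j i) j, hs.le, ?_⟩
        rw [wordValue, hs, Fin.tail_cons, hN]
        omega

theorem le_choose_add (ℓ q : ℕ) (hℓ : 1 ≤ ℓ) : q + 1 ≤ (q + ℓ).choose ℓ := by
  rw [← Nat.choose_symm_add]
  calc q + 1 = (q + 1).choose q := by simp
    _ ≤ _ := Nat.choose_le_choose _ (by omega)

theorem wordValue_surjective (ℓ : ℕ) (hℓ : 1 ≤ ℓ) : Function.Surjective (wordValue ℓ) := by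
  intro N
  obtain ⟨j, -, hj⟩ := exists_wordValue_eq_of_lt ℓ N N (le_choose_add ℓ N hℓ)
  exact ⟨j, hj⟩

theorem genLT_powWord_succ {ℓ : ℕ} {i j : Fin (ℓ + 1) → ℕ} (h : ∑ k, i k = ∑ k, j k)
    (ht : GenLT (powWord ℓ (Fin.tail i)) (powWord ℓ (Fin.tail j))) :
    GenLT (powWord (ℓ + 1) i) (powWord (ℓ + 1) j) := by
  unfold GenLT at *
  rw [List.shortlex_def] at *
  right
  refine ⟨by simp [length_powWord, h], ?_⟩
  rw [powWord_succ, powWord_succ]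
  rw [sum_tail_add, sum_tail_add] at h
  rw [length_powWord, length_powWord] at ht
  rcases ht with ht | ⟨ht, hlex⟩
  -- A shorter tail means more copies of the least letter; the first extra copy faces a larger
  -- letter.
  · obtain ⟨d, hd⟩ : ∃ d, i 0 = j 0 + (d + 1) := ⟨i 0 - j 0 - 1, by omega⟩
    have hpos : powWord ℓ (Fin.tail j) ≠ [] := by
      rw [← List.length_pos_iff, length_powWord]; omega
    obtain ⟨x, xs, hx⟩ := List.exists_cons_of_ne_nil hpos
    rw [hd, List.replicate_add, hx, List.append_assoc]
    refine List.Lex.append_left _ ?_ _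
    rw [List.replicate_succ, List.map_cons, List.cons_append]
    exact List.Lex.rel (Fin.succ_pos x)
  · rw [show i 0 = j 0 by omega]
    refine List.Lex.append_left _ ?_ _
    refine (?_ : List.map Fin.succ _ < List.map Fin.succ _)
    exact List.map_lt (fun x y hxy => Fin.succ_lt_succ_iff.2 hxy) hlex

theorem genLT_powWord_of_wordValue_lt {ℓ : ℕ} {i j : Fin ℓ → ℕ}
    (h : wordValue ℓ i < wordValue ℓ j) : GenLT (powWord ℓ i) (powWord ℓ j) := by
  induction ℓ with
  | zero => simp [wordValue] at h
  | succ ℓ ih =>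
    rcases lt_trichotomy (∑ k, i k) (∑ k, j k) with h' | h' | h'
    · unfold GenLT
      rw [List.shortlex_def]
      exact Or.inl (by simpa [length_powWord] using h')
    · refine genLT_powWord_succ h' (ih ?_)
      rw [wordValue, wordValue, h'] at h
      exact Nat.lt_of_add_lt_add_left h
    · exact absurd h (wordValue_lt_of_sum_lt h').not_gt

theorem genLT_powWord_iff {ℓ : ℕ} {i j : Fin ℓ → ℕ} :
    GenLT (powWord ℓ i) (powWord ℓ j) ↔ wordValue ℓ i < wordValue ℓ j := by
  refine ⟨fun h => ?_, genLT_powWord_of_wordValue_lt⟩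
  rcases lt_trichotomy (wordValue ℓ i) (wordValue ℓ j) with h' | h' | h'
  · exact h'
  · rw [wordValue_injective ℓ h'] at h
    exact absurd h (genLT_irrefl _)
  · exact absurd (genLT_trans h (genLT_powWord_of_wordValue_lt h')) (genLT_irrefl _)

theorem powWord_injective (ℓ : ℕ) : Function.Injective (powWord ℓ) := by
  intro i j h
  refine wordValue_injective ℓ (le_antisymm ?_ ?_) <;>
  · refine le_of_not_gt fun h' => ?_
    have := genLT_powWord_of_wordValue_lt h'
    rw [h] at this
    exact genLT_irrefl _ this

theorem val_powWord {ℓ : ℕ} (hℓ : 1 ≤ ℓ) (j : Fin ℓ → ℕ) :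
    val (boundedLang ℓ) (powWord ℓ j) = wordValue ℓ j := by
  have hset : {v : List (Fin ℓ) | v ∈ boundedLang ℓ ∧ GenLT v (powWord ℓ j)} =
      powWord ℓ '' (wordValue ℓ ⁻¹' Set.Iio (wordValue ℓ j)) := by
    ext v
    constructor
    · rintro ⟨⟨i, rfl⟩, h⟩
      exact ⟨i, genLT_powWord_iff.1 h, rfl⟩
    · rintro ⟨i, h, rfl⟩
      exact ⟨⟨i, rfl⟩, genLT_powWord_iff.2 h⟩
  -- Surjectivity of `wordValue` makes the count of smaller words equal to the value itself.
  rw [val, hset, Set.ncard_image_of_injective _ (powWord_injective ℓ),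
    Set.ncard_preimage_of_injective_subset_range (wordValue_injective ℓ)
      (by rw [(wordValue_surjective ℓ hℓ).range_eq]; exact Set.subset_univ _)]
  simp [Set.ncard_eq_toFinset_card']

theorem replicate_last_eq_powWord (ℓ q : ℕ) :
    List.replicate q (Fin.last ℓ) = powWord (ℓ + 1) (Pi.single (Fin.last ℓ) q) := by
  induction ℓ with
  | zero => simp [powWord]
  | succ ℓ ih =>
    have ht : Fin.tail (Pi.single (Fin.last (ℓ + 1)) q : Fin (ℓ + 2) → ℕ) =
        Pi.single (Fin.last ℓ) q := by
      ext i
      simp [Fin.tail, Pi.single_apply, ← Fin.succ_last]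
    rw [powWord_succ, ht, ← ih]
    simp [Fin.last_pos.ne]

theorem wordValue_single_last (ℓ q : ℕ) :
    wordValue (ℓ + 1) (Pi.single (Fin.last ℓ) q) + 1 = (q + (ℓ + 1)).choose (ℓ + 1) := by
  induction ℓ with
  | zero => simp [wordValue]
  | succ ℓ ih =>
    have ht : Fin.tail (Pi.single (Fin.last (ℓ + 1)) q : Fin (ℓ + 2) → ℕ) =
        Pi.single (Fin.last ℓ) q := by
      ext i
      simp [Fin.tail, Pi.single_apply, ← Fin.succ_last]
    rw [wordValue, ht, add_assoc, ih, Finset.sum_pi_single' ]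
    simp only [Finset.mem_univ, if_true]
    rw [show q + (ℓ + 1 + 1) = q + (ℓ + 1) + 1 by omega, Nat.choose_succ_succ, add_comm]

/-! ### Pumping a single letter in a regular language -/

theorem exists_iterate_period {σ : Type*} [Finite σ] (f : σ → σ) :
    ∃ P T : ℕ, 0 < T ∧ ∀ k, P ≤ k → ∀ x, f^[k + T] x = f^[k] x := by
  obtain ⟨m, n, hmn, h⟩ := Finite.exists_ne_map_eq_of_infinite fun k : ℕ => f^[k]
  wlog hlt : m < n generalizing m n
  · exact this n m hmn.symm h.symm (by omega)
  refine ⟨m, n - m, by omega, fun k hk x => ?_⟩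
  obtain ⟨c, rfl⟩ := Nat.exists_eq_add_of_le' hk
  rw [show c + m + (n - m) = c + n by omega, Function.iterate_add_apply,
    Function.iterate_add_apply, (congrFun h x : f^[m] x = f^[n] x)]

theorem evalFrom_replicate {α σ : Type*} (M : DFA α σ) (s : σ) (a : α) (k : ℕ) :
    M.evalFrom s (List.replicate k a) = (fun t => M.step t a)^[k] s := by
  induction k generalizing s with
  | zero => rfl
  | succ k ih => rw [List.replicate_succ, DFA.evalFrom_cons, ih]; rfl

theorem exists_pump_letter {α : Type*} {K : Language α} (hK : K.IsRegular) (a : α) :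
    ∃ P T : ℕ, 0 < T ∧ ∀ k, P ≤ k → ∀ x y : List α,
      x ++ List.replicate k a ++ y ∈ K → x ++ List.replicate (k + T) a ++ y ∈ K := by
  obtain ⟨σ, _, M, rfl⟩ := hK
  obtain ⟨P, T, hT, h⟩ := exists_iterate_period fun t => M.step t a
  refine ⟨P, T, hT, fun k hk x y hxy => ?_⟩
  rw [DFA.mem_accepts, DFA.eval, DFA.evalFrom_of_append, DFA.evalFrom_of_append,
    evalFrom_replicate] at hxy ⊢
  rwa [h k hk]

theorem exists_powWord_update {ℓ : ℕ} (j : Fin ℓ → ℕ) (i : Fin ℓ) :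
    ∃ x y : List (Fin ℓ), ∀ k,
      powWord ℓ (Function.update j i k) = x ++ List.replicate k i ++ y := by
  induction ℓ with
  | zero => exact i.elim0
  | succ ℓ ih =>
    refine Fin.cases ?_ (fun i => ?_) i
    · refine ⟨[], (powWord ℓ (Fin.tail j)).map Fin.succ, fun k => ?_⟩
      rw [powWord_succ, Fin.tail_update_zero]
      simp
    · obtain ⟨x, y, h⟩ := ih (Fin.tail j) i
      refine ⟨List.replicate (j 0) 0 ++ x.map Fin.succ, y.map Fin.succ, fun k => ?_⟩
      rw [powWord_succ, Fin.tail_update_succ, h k,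
        Function.update_of_ne (Fin.succ_ne_zero i).symm]
      simp

theorem exists_pump_powWord {ℓ : ℕ} {K : Language (Fin ℓ)} (hK : K.IsRegular) :
    ∃ P : ℕ, ∀ (j : Fin ℓ → ℕ) (i : Fin ℓ), P ≤ j i → powWord ℓ j ∈ K →
      ∃ T : ℕ, 0 < T ∧ ∀ s : ℕ, powWord ℓ (Function.update j i (j i + s * T)) ∈ K := by
  choose P T hT h using exists_pump_letter hK
  -- The sum of the thresholds dominates the threshold of every letter.
  refine ⟨∑ a, P a, fun j i hi hj => ⟨T i, hT i, fun s => ?_⟩⟩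
  obtain ⟨x, y, hxy⟩ := exists_powWord_update j i
  have hP : P i ≤ j i :=
    (Finset.single_le_sum (fun a _ => Nat.zero_le (P a)) (Finset.mem_univ i)).trans hi
  induction s with
  | zero => simpa using hj
  | succ s ih =>
    rw [hxy] at ih ⊢
    rw [Nat.succ_mul, ← add_assoc]
    exact h i _ (by omega) x y ih

/-! ### Asymptotics of products of arithmetic progressions -/

/-- The constants are the first two elementary symmetric functions of the terms `b + c * i`; the
induction multiplies by one more factor. -/
theorem tendsto_prod_arith_second (b c : ℝ) (k : ℕ) :
    Tendsto (fun z : ℝ => ((∏ i ∈ Finset.range (k + 2), (z + b + c * i)) - z ^ (k + 2) -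
      ((k + 2) * b + c * ((k + 2) * (k + 1) / 2)) * z ^ (k + 1)) / z ^ k) atTop
      (𝓝 ((k + 2) * (k + 1) * (b ^ 2 / 2 + b * c * (k + 1) / 2 + c ^ 2 * k * (3 * k + 5) / 24))) := by
  induction k with
  | zero =>
    refine tendsto_const_nhds.congr fun z => ?_
    simp [Finset.prod_range_succ]
    ring
  | succ k ih =>
    have h1 := (ih.add (((ih.mul tendsto_inv_atTop_zero).add_const
      ((k + 2) * b + c * ((k + 2) * (k + 1) / 2))).const_mul (b + c * (k + 2))))
    refine Tendsto.congr' ?_ (h1.trans_eq ?_)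
    · filter_upwards [eventually_gt_atTop 0] with z hz
      rw [Finset.prod_range_succ _ (k + 2)]
      generalize ∏ i ∈ Finset.range (k + 2), (z + b + c * i) = p
      push_cast
      field_simp
      ring
    · congr 1
      push_cast
      ring

theorem tendsto_prod_arith_first (b c : ℝ) (k : ℕ) :
    Tendsto (fun z : ℝ => ((∏ i ∈ Finset.range (k + 1), (z + b + c * i)) - z ^ (k + 1)) / z ^ k)
      atTop (𝓝 ((k + 1) * (b + c * k / 2))) := by
  induction k with
  | zero =>
    refine tendsto_const_nhds.congr fun z => ?_
    simp
  | succ k ih =>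
    have h1 := (ih.add (((ih.mul tendsto_inv_atTop_zero).add_const 1).const_mul (b + c * (k + 1))))
    refine Tendsto.congr' ?_ (h1.trans_eq ?_)
    · filter_upwards [eventually_gt_atTop 0] with z hz
      rw [Finset.prod_range_succ _ (k + 1)]
      generalize ∏ i ∈ Finset.range (k + 1), (z + b + c * i) = p
      push_cast
      field_simp
      ring
    · congr 1
      push_cast
      ring

theorem tendsto_prod_arith_zeroth (b c : ℝ) (k : ℕ) :
    Tendsto (fun z : ℝ => (∏ i ∈ Finset.range k, (z + b + c * i)) / z ^ k) atTop (𝓝 1) := by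
  induction k with
  | zero => simp
  | succ k ih =>
    have h1 := ih.mul ((tendsto_inv_atTop_zero.const_mul (b + c * k)).const_add 1)
    refine Tendsto.congr' ?_ (h1.trans_eq (by simp))
    filter_upwards [eventually_gt_atTop 0] with z hz
    rw [Finset.prod_range_succ]
    field_simp
    ring

theorem factorial_mul_choose (n k : ℕ) :
    ((k.factorial : ℝ)) * ((n + k).choose k : ℝ) = ∏ i ∈ Finset.range k, ((n : ℝ) + 1 + i) := by
  have h : (n + 1).ascFactorial k = k.factorial * (n + k).choose k :=
    Nat.ascFactorial_eq_factorial_mul_choose n k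
  rw [← Nat.cast_mul, ← h, Nat.ascFactorial_eq_prod_range]
  push_cast
  rfl

theorem factorial_mul_choose' (n k : ℕ) :
    (((k + 1).factorial : ℝ)) * ((n + k).choose (k + 1) : ℝ) =
      ∏ i ∈ Finset.range (k + 1), ((n : ℝ) + i) := by
  have h : n.ascFactorial (k + 1) = (k + 1).factorial * (n + (k + 1) - 1).choose (k + 1) :=
    Nat.ascFactorial_eq_factorial_mul_choose' n (k + 1)
  rw [show n + (k + 1) - 1 = n + k by omega] at h
  rw [← Nat.cast_mul, ← h, Nat.ascFactorial_eq_prod_range]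
  push_cast
  rfl

/-- Along an arithmetic progression `n`, a sequence lying between two consecutive binomial
coefficients of order `k + 1` of `m = n - const` grows like `n ^ (k + 1) / (k + 1)!`. -/
theorem tendsto_of_choose_bounds {z : ℕ → ℝ} (hz : Tendsto z atTop atTop) {m v : ℕ → ℕ} {d : ℝ}
    {k : ℕ} (hm : ∀ s, (m s : ℝ) = z s + d) (hl : ∀ s, (m s + k).choose (k + 1) ≤ v s)
    (hu : ∀ s, v s < (m s + (k + 1)).choose (k + 1)) :
    Tendsto (fun s => ((k + 1).factorial : ℝ) * v s / z s ^ (k + 1)) atTop (𝓝 1) := by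
  have h1 := (tendsto_prod_arith_zeroth d 1 (k + 1)).comp hz
  have h2 := (tendsto_prod_arith_zeroth (d + 1) 1 (k + 1)).comp hz
  refine tendsto_of_tendsto_of_tendsto_of_le_of_le' h1 h2 ?_ ?_
  · filter_upwards [hz.eventually_gt_atTop 0] with s hs
    have := factorial_mul_choose' (m s) k
    simp only [Function.comp, one_mul]
    rw [hm] at this
    rw [← this]
    gcongr
    exact hl s
  · filter_upwards [hz.eventually_gt_atTop 0] with s hs
    have := factorial_mul_choose (m s) (k + 1)
    simp only [Function.comp, one_mul]
    rw [hm] at this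
    simp only [← add_assoc (z s)]
    rw [← this]
    gcongr
    exact (hu s).le

theorem tendsto_const_bound_div_pow {z : ℕ → ℝ} (hz : Tendsto z atTop atTop) {v : ℕ → ℕ} {B : ℕ}
    (hv : ∀ s, v s ≤ B) (c : ℝ) (hc : 0 ≤ c) (k : ℕ) :
    Tendsto (fun s => c * v s / z s ^ (k + 1)) atTop (𝓝 0) := by
  have h2 : Tendsto (fun s => c * B / z s ^ (k + 1)) atTop (𝓝 0) :=
    Tendsto.div_atTop tendsto_const_nhds ((tendsto_pow_atTop (by omega)).comp hz)
  refine tendsto_of_tendsto_of_tendsto_of_le_of_le' tendsto_const_nhds h2 ?_ ?_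
  · filter_upwards [hz.eventually_gt_atTop 0] with s hs
    positivity
  · filter_upwards [hz.eventually_gt_atTop 0] with s hs
    gcongr
    exact hv s

/-! ### Comparing expansions to second order -/

/-- If a product of an arithmetic progression starting at a lattice point `β * q + β` agrees to
first order with `z ^ (k + 2)` corrected by `e`, then `q` is determined exactly by `z`. -/
theorem eventually_eq_of_first_order {β k : ℕ} {n q : ℕ → ℕ}
    (hz : Tendsto (fun s => (n s : ℝ)) atTop atTop) {e : ℤ}
    (hF : Tendsto (fun s => ((∏ i ∈ Finset.range (k + 2), ((β * q s + β : ℝ) + β * i)) -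
      (n s : ℝ) ^ (k + 2)) / (n s : ℝ) ^ (k + 1)) atTop
      (𝓝 ((k + 2) * (k + 1) / 2 + (k + 2) * e))) :
    ∀ᶠ s in atTop, 2 * (β * q s : ℝ) + β * (k + 3) - 2 * n s - (k + 1) = 2 * e := by
  -- The offset is chosen so that this product has first-order coefficient `(k + 2) * t / 2` above
  -- that of `hF`. Comparing factors for `t = 1` and `t = -1` traps an integer strictly between `2 *
  -- e - 1` and `2 * e + 1`.
  have hG (t : ℝ) := (tendsto_prod_arith_first
    (β + (2 * e + t + (k + 1) - β * (k + 3)) / 2) β (k + 1)).comp hz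
  have h1 := hF.eventually_lt (hG 1) (by push_cast; nlinarith)
  have h2 := (hG (-1)).eventually_lt hF (by push_cast; nlinarith)
  filter_upwards [h1, h2, hz.eventually_gt_atTop 0, hz.eventually_ge_atTop
    (-(β + (2 * e + 1 + (k + 1) - β * (k + 3)) / 2 : ℝ))] with s h1 h2 hs hb
  simp only [Function.comp] at h1 h2
  rw [div_lt_div_iff_of_pos_right (by positivity), sub_lt_sub_iff_right] at h1 h2
  have hup : (2 * (β * q s : ℝ) + β * (k + 3) - 2 * n s - (k + 1)) < 2 * e + 1 := by
    by_contra! hcon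
    refine h1.not_ge (Finset.prod_le_prod (fun i _ => ?_) fun i _ => ?_)
    · have : (0 : ℝ) ≤ β * i := by positivity
      linarith
    · linarith
  have hlo : (2 * e - 1 : ℝ) < (2 * (β * q s : ℝ) + β * (k + 3) - 2 * n s - (k + 1)) := by
    by_contra! hcon
    refine h2.not_ge (Finset.prod_le_prod (fun i _ => ?_) fun i _ => ?_)
    · positivity
    · linarith
  have hup' : (2 * (β * q s : ℤ) + β * (k + 3) - 2 * n s - (k + 1)) < 2 * e + 1 := by
    exact_mod_cast hup
  have hlo' : (2 * e - 1 : ℤ) < (2 * (β * q s : ℤ) + β * (k + 3) - 2 * n s - (k + 1)) := by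
    exact_mod_cast hlo
  have : (2 * (β * q s : ℤ) + β * (k + 3) - 2 * n s - (k + 1)) = 2 * e := by omega
  exact_mod_cast this

/-- Second order comparison of `β ^ ℓ * (C(q + ℓ, ℓ) - 1)` with `C(n + ℓ - 1, ℓ) + u`, `ℓ = k + 3`,
where `ℓ! * u` has the expansion `ℓ * e * n ^ (ℓ - 1) + g * n ^ (ℓ - 2) + ⋯`. -/
theorem second_order_comparison {β k : ℕ} {n q u : ℕ → ℕ}
    (hz : Tendsto (fun s => (n s : ℝ)) atTop atTop)
    (hV : ∀ s, β ^ (k + 3) * ((q s + (k + 3)).choose (k + 3)) =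
      (n s + (k + 2)).choose (k + 3) + u s + β ^ (k + 3)) {e : ℤ} {g : ℝ}
    (hU : Tendsto (fun s => (((k + 3).factorial : ℝ) * u s - (k + 3) * e * (n s : ℝ) ^ (k + 2)) /
      (n s : ℝ) ^ (k + 1)) atTop (𝓝 g)) :
    (∃ a b : ℤ, 2 * (β * a : ℝ) + β * (k + 4) - 2 * b - (k + 2) = 2 * e) ∧
    (k + 3 : ℝ) * (k + 2) * ((e + (k + 2) / 2 - β * (k + 2) / 2) ^ 2 / 2 +
      (e + (k + 2) / 2 - β * (k + 2) / 2) * β * (k + 2) / 2 +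
      (β : ℝ) ^ 2 * (k + 1) * (3 * (k + 1) + 5) / 24) =
    (k + 3 : ℝ) * (k + 2) * ((k + 1) * (3 * (k + 1) + 5) / 24) + g := by
  have hF (s : ℕ) : ∏ i ∈ Finset.range (k + 3), ((β * q s + β : ℝ) + β * i) =
      ∏ i ∈ Finset.range (k + 3), ((n s : ℝ) + 0 + 1 * i) + (k + 3).factorial * u s +
        (k + 3).factorial * β ^ (k + 3) := by
    have h1 : ∏ i ∈ Finset.range (k + 3), ((β * q s + β : ℝ) + β * i) =
        β ^ (k + 3) * ∏ i ∈ Finset.range (k + 3), ((q s : ℝ) + 1 + i) := by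
      rw [← Finset.card_range (k + 3), ← Finset.prod_const, Finset.card_range,
        ← Finset.prod_mul_distrib]
      exact Finset.prod_congr rfl fun i _ => by ring
    have h2 := factorial_mul_choose' (n s) (k + 2)
    have h3 := congrArg (fun x : ℕ => (x : ℝ)) (hV s)
    push_cast at h3
    rw [h1, ← factorial_mul_choose]
    simp only [add_zero, one_mul]
    rw [← h2]
    linear_combination ((k + 3).factorial : ℝ) * h3
  have hconst : Tendsto (fun s => ((k + 3).factorial : ℝ) * β ^ (k + 3) / (n s : ℝ) ^ (k + 1))
      atTop (𝓝 0) :=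
    Tendsto.div_atTop tendsto_const_nhds ((tendsto_pow_atTop (by omega)).comp hz)
  have hsec : Tendsto (fun s => ((∏ i ∈ Finset.range (k + 3), ((β * q s + β : ℝ) + β * i)) -
      (n s : ℝ) ^ (k + 3) - ((k + 3) * (k + 2) / 2 + (k + 3) * e) * (n s : ℝ) ^ (k + 2)) /
      (n s : ℝ) ^ (k + 1)) atTop
      (𝓝 ((k + 3 : ℝ) * (k + 2) * ((k + 1) * (3 * (k + 1) + 5) / 24) + g)) := by
    have h := ((((tendsto_prod_arith_second 0 1 (k + 1)).comp hz).add hU).add hconst)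
    refine (h.congr fun s => ?_).trans_eq ?_
    · simp only [Function.comp]
      rw [hF, ← add_div, ← add_div]
      congr 1
      push_cast
      ring
    · congr 1
      push_cast
      ring
  have hinv := tendsto_inv_atTop_zero.comp hz
  have hfirst : Tendsto (fun s => ((∏ i ∈ Finset.range (k + 3), ((β * q s + β : ℝ) + β * i)) -
      (n s : ℝ) ^ (k + 3)) / (n s : ℝ) ^ (k + 2)) atTop
      (𝓝 ((k + 3) * (k + 2) / 2 + (k + 3) * e)) := by
    have h := (hsec.mul hinv).add_const ((k + 3) * (k + 2) / 2 + (k + 3) * e : ℝ)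
    refine Tendsto.congr' ?_ (h.trans_eq (by simp))
    filter_upwards [hz.eventually_gt_atTop 0] with s hs
    simp only [Function.comp]
    field_simp
    ring
  have hev := eventually_eq_of_first_order (β := β) (k := k + 1) (e := e) hz
    (hfirst.trans_eq (by congr 1; push_cast; ring))
  refine ⟨?_, ?_⟩
  · obtain ⟨s, hs⟩ := hev.exists
    refine ⟨q s, n s, ?_⟩
    push_cast at hs ⊢
    linarith
  -- With `β * q - n` known exactly, the left product is a progression starting at `n` plus a
  -- constant, so its second coefficient is explicit and must agree with the limit in `hsec`.
  · have h := (tendsto_prod_arith_second (e + (k + 2) / 2 - β * (k + 2) / 2) β (k + 1)).comp hz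
    refine tendsto_nhds_unique (Tendsto.congr' ?_ (h.trans_eq ?_)) hsec
    · filter_upwards [hev] with s hs
      have hb : (n s : ℝ) + (e + (k + 2) / 2 - β * (k + 2) / 2) = β * q s + β := by
        push_cast at hs
        linarith
      simp only [Function.comp]
      rw [hb]
      congr 1
      push_cast
      ring
    · congr 1
      push_cast
      ring

/-- The two progressions then have the same mean, but their variances differ by the factor `β ^ 2`,
which the second coefficient detects. -/
theorem not_bounded_remainder {β k : ℕ} (hβ : 2 ≤ β) {n q u : ℕ → ℕ} {B : ℕ}
    (hz : Tendsto (fun s => (n s : ℝ)) atTop atTop)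
    (hV : ∀ s, β ^ (k + 3) * ((q s + (k + 3)).choose (k + 3)) =
      (n s + (k + 2)).choose (k + 3) + u s + β ^ (k + 3)) (hu : ∀ s, u s ≤ B) : False := by
  have hU := tendsto_const_bound_div_pow hz hu ((k + 3).factorial : ℝ) (by positivity) k
  obtain ⟨-, h⟩ := second_order_comparison (e := 0) (g := 0) hz hV
    (hU.congr fun s => by simp)
  have hβ' : (2 : ℝ) ≤ β := by exact_mod_cast hβ
  have h' : ((k : ℝ) + 3) * (k + 2) * (k + 4) * (β ^ 2 - 1) = 0 := by
    push_cast at h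
    linear_combination (-24) * h
  have : (0 : ℝ) < (β : ℝ) ^ 2 - 1 := by nlinarith
  have : (0 : ℝ) < ((k : ℝ) + 3) * (k + 2) * (k + 4) * (β ^ 2 - 1) := by positivity
  exact this.ne' h'

theorem integrality_of_expansion {β k : ℕ} {n m q v : ℕ → ℕ} {d : ℕ}
    (hz : Tendsto (fun s => (n s : ℝ)) atTop atTop)
    (hV : ∀ s, β ^ (k + 3) * ((q s + (k + 3)).choose (k + 3)) =
      (n s + (k + 2)).choose (k + 3) + ((m s + (k + 1)).choose (k + 2) + v s) + β ^ (k + 3))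
    (hm : ∀ s, n s = d + m s) {e : ℤ}
    (hv : Tendsto (fun s => ((k + 1).factorial : ℝ) * v s / (n s : ℝ) ^ (k + 1)) atTop (𝓝 e)) :
    (∃ z : ℤ, ((β : ℝ) - 1) * (k + 4) / 2 = z) ∧
      ∃ z : ℤ, ((β : ℝ) ^ 2 - 1) * (k + 4) / 24 = z := by
  have hP := (tendsto_prod_arith_first (-d) 1 (k + 1)).comp hz
  obtain ⟨⟨a, b, h1⟩, h2⟩ := second_order_comparison (e := 1)
    (g := (k + 3) * ((k + 2) * (-d + (k + 1) / 2)) + (k + 3) * (k + 2) * e) hz hV (by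
      refine Tendsto.congr (fun s => ?_) (((hP.const_mul (k + 3 : ℝ)).add
        (hv.const_mul ((k + 3 : ℝ) * (k + 2)))).trans_eq ?_)
      · have h := factorial_mul_choose' (m s) (k + 1)
        have hms : (m s : ℝ) = n s + -d := by rw [hm s]; push_cast; ring
        simp only [Function.comp, one_mul]
        rw [← hms, ← h, Nat.factorial_succ (k + 2), Nat.factorial_succ (k + 1)]
        push_cast
        ring
      · congr 1
        push_cast
        ring)
  constructor
  · refine ⟨b - β * a, ?_⟩
    push_cast at h1 ⊢
    linarith
  · refine ⟨d + 1 - e, ?_⟩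
    push_cast at h2 ⊢
    have hk : ((k : ℝ) + 3) * (k + 2) ≠ 0 := by positivity
    refine mul_left_cancel₀ hk ?_
    linear_combination -h2

/-! ### Pumped words in the image -/

theorem sum_update_add {ℓ : ℕ} (j : Fin ℓ → ℕ) (i : Fin ℓ) (a : ℕ) :
    ∑ x, Function.update j i (j i + a) x = ∑ x, j x + a := by
  have h := Finset.add_sum_erase Finset.univ j (Finset.mem_univ i)
  rw [Finset.sum_update_of_mem (Finset.mem_univ i), ← Finset.erase_eq, ← h]
  omega

theorem tendsto_sum_update {ℓ : ℕ} (j : Fin ℓ → ℕ) (i : Fin ℓ) {T : ℕ} (hT : 0 < T) :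
    Tendsto (fun s : ℕ => ((∑ x, Function.update j i (j i + s * T) x : ℕ) : ℝ)) atTop atTop := by
  refine tendsto_natCast_atTop_atTop.comp (tendsto_atTop_mono (fun s => ?_) tendsto_id)
  rw [sum_update_add]
  exact (Nat.le_mul_of_pos_right s hT).trans (Nat.le_add_left _ _)

theorem integrality_of_pump {β k : ℕ} (hβ : 2 ≤ β) (j : Fin (k + 3) → ℕ) (i : Fin (k + 3)) {T : ℕ}
    (hT : 0 < T) (q : ℕ → ℕ)
    (hV : ∀ s, β ^ (k + 3) * ((q s + (k + 3)).choose (k + 3)) =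
      wordValue (k + 3) (Function.update j i (j i + s * T)) + β ^ (k + 3)) :
    (∃ z : ℤ, ((β : ℝ) - 1) * (k + 4) / 2 = z) ∧
      ∃ z : ℤ, ((β : ℝ) ^ 2 - 1) * (k + 4) / 24 = z := by
  have hz := tendsto_sum_update j i hT
  rcases Fin.eq_zero_or_eq_succ i with rfl | ⟨i, rfl⟩
  · refine (not_bounded_remainder hβ hz hV (B := wordValue (k + 2) (Fin.tail j)) fun s => ?_).elim
    rw [Fin.tail_update_zero]
  · have hm (s : ℕ) : ∑ x, Function.update j i.succ (j i.succ + s * T) x = j 0 +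
        ∑ x, Fin.tail (Function.update j i.succ (j i.succ + s * T)) x := by
      rw [sum_tail_add, Function.update_of_ne (Fin.succ_ne_zero i).symm]
    rcases Fin.eq_zero_or_eq_succ i with rfl | ⟨i, rfl⟩
    · refine integrality_of_expansion (e := 0) hz hV hm ?_
      rw [Int.cast_zero]
      refine tendsto_const_bound_div_pow hz
        (B := wordValue (k + 1) (Fin.tail (Fin.tail j))) (fun s => ?_) _ (by positivity) k
      rw [Fin.tail_update_succ, Fin.tail_update_zero]
    -- From the third letter on, the remaining tail has length `n` minus a constant, so its value is
    -- asymptotic to `n ^ (k + 1) / (k + 1)!`.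
    · refine integrality_of_expansion (e := 1) hz hV hm ?_
      rw [Int.cast_one]
      refine tendsto_of_choose_bounds hz (d := -(j 0 + j 1 : ℝ))
        (m := fun s => ∑ x, Fin.tail (Fin.tail
          (Function.update j i.succ.succ (j i.succ.succ + s * T))) x)
        (fun s => ?_) (fun s => choose_le_wordValue (k + 1) (by omega) _)
        (fun s => wordValue_lt (k + 1) _)
      rw [hm s, sum_tail_add (k + 1)
        (Fin.tail (Function.update j i.succ.succ (j i.succ.succ + s * T)))]
      have : Fin.tail (Function.update j i.succ.succ (j i.succ.succ + s * T)) 0 = j 1 :=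
        Function.update_of_ne (fun h => Fin.succ_ne_zero i (Fin.succ_injective _ h).symm) _ _
      rw [this]
      push_cast
      ring

theorem val_replicate_last (ℓ q : ℕ) :
    val (boundedLang (ℓ + 1)) (List.replicate q (Fin.last ℓ)) + 1 =
      (q + (ℓ + 1)).choose (ℓ + 1) := by
  rw [replicate_last_eq_powWord, val_powWord (by omega), wordValue_single_last]

theorem val_mulMap_replicate_last (ℓ m q : ℕ) :
    val (boundedLang (ℓ + 1)) (mulMap (ℓ + 1) m (List.replicate q (Fin.last ℓ))) + m =
      m * (q + (ℓ + 1)).choose (ℓ + 1) := by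
  rw [mulMap, val_rep (infinite_boundedLang (by omega)), ← val_replicate_last, mul_add_one]

/-- If all exponents were below `P`, the word would have length at most `(ℓ + 1) * P`, hence value
below `q`; but its value is at least `q`. -/
theorem exists_powWord_mem_mulImage {ℓ m : ℕ} (hm : 0 < m) (P : ℕ) :
    ∃ (j : Fin (ℓ + 1) → ℕ) (i : Fin (ℓ + 1)), P ≤ j i ∧
      powWord (ℓ + 1) j ∈ mulImage (ℓ + 1) m (letterStar (Fin.last ℓ)) := by
  obtain ⟨j, hj⟩ := rep_mem (infinite_boundedLang (ℓ := ℓ + 1) (by omega))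
    (m * val (boundedLang (ℓ + 1)) (List.replicate (((ℓ + 1) * P + (ℓ + 1)).choose (ℓ + 1))
      (Fin.last ℓ)))
  set q := ((ℓ + 1) * P + (ℓ + 1)).choose (ℓ + 1) with hq
  have hmem : powWord (ℓ + 1) j ∈ mulImage (ℓ + 1) m (letterStar (Fin.last ℓ)) :=
    ⟨_, ⟨q, rfl⟩, hj⟩
  by_contra! hcon
  have hsum : ∑ i, j i ≤ (ℓ + 1) * P := by
    have := Finset.sum_le_card_nsmul Finset.univ j P fun i _ => by
      by_contra! h
      exact hcon j i h.le hmem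
    simpa using this
  have h1 : wordValue (ℓ + 1) j < q :=
    (wordValue_lt _ _).trans_le (Nat.choose_le_choose _ (by omega))
  have h2 : wordValue (ℓ + 1) j = m * val (boundedLang (ℓ + 1)) (List.replicate q (Fin.last ℓ)) := by
    rw [← val_powWord (by omega), ← hj, val_rep (infinite_boundedLang (by omega))]
  have h3 := val_replicate_last ℓ q
  have h4 := le_choose_add (ℓ + 1) q (by omega)
  have h5 := Nat.le_mul_of_pos_left (val (boundedLang (ℓ + 1)) (List.replicate q (Fin.last ℓ))) hm
  omega

end BoundedNumeration

open BoundedNumeration in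
theorem mainTheorem2 (ℓ β : ℕ) (hℓ : 3 ≤ ℓ) (hβ : 2 ≤ β)
    (h : (¬ ∃ z : ℤ, ((β : ℚ) - 1) * ((ℓ : ℚ) + 1) / 2 = (z : ℚ)) ∨
      (¬ ∃ z : ℤ, ((β : ℚ) ^ 2 - 1) * ((ℓ : ℚ) + 1) / 24 = (z : ℚ))) :
    ¬ (BoundedNumeration.mulImage ℓ (β ^ ℓ)
        (BoundedNumeration.letterStar (⟨ℓ - 1, by omega⟩ : Fin ℓ))).IsRegular := by
  intro hreg
  obtain ⟨k, rfl⟩ := Nat.exists_eq_add_of_le' hℓ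
  rw [show (⟨k + 3 - 1, by omega⟩ : Fin (k + 3)) = Fin.last (k + 2) from rfl] at hreg
  obtain ⟨P, hP⟩ := exists_pump_powWord hreg
  obtain ⟨j, i, hi, hj⟩ :=
    exists_powWord_mem_mulImage (ℓ := k + 2) (m := β ^ (k + 3)) (by positivity) P
  obtain ⟨T, hT, hpump⟩ := hP j i hi hj
  have hex (s : ℕ) : ∃ q : ℕ, β ^ (k + 3) * ((q + (k + 3)).choose (k + 3)) =
      wordValue (k + 3) (Function.update j i (j i + s * T)) + β ^ (k + 3) := by
    obtain ⟨_, ⟨q, rfl⟩, hw⟩ := hpump s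
    refine ⟨q, ?_⟩
    rw [← val_powWord (by omega), ← hw, val_mulMap_replicate_last]
  choose q hq using hex
  obtain ⟨⟨a, ha⟩, ⟨b, hb⟩⟩ := integrality_of_pump hβ j i hT q hq
  have h4 : ((k + 3 : ℕ) : ℚ) + 1 = k + 4 := by push_cast; ring
  rw [h4] at h
  rcases h with h | h
  · exact h ⟨a, by exact_mod_cast ha⟩
  · exact h ⟨b, by exact_mod_cast hb⟩
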